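/- Let $p,m\in\mathbb N$ and, for $i=1,\dots,p$, let $\alpha_i\in(0,\infty)\setminus\mathbb N$ and $n_i=[\alpha_i]+1$. For each $i$ let $D^{\alpha_i}$ denote one of the following three fractional derivatives of order $\alpha=\alpha_i$ with base point $0$ (where $n=n_i$, $t>0$): the Riemann–Liouville derivative $\frac{1}{\Gamma(n-\alpha)}\left(\frac{d}{dt}\right)^n\int_0^t(t-s)^{n-\alpha-1}g(s)\,ds$, the Caputo derivative $\frac{1}{\Gamma(n-\alpha)}\int_0^t(t-s)^{n-\alpha-1}g^{(n)}(s)\,ds$, or the Grünwald–Letnikov derivative $\lim_{h\to0^+}h^{-\alpha}\sum_{r=0}^{[t/h]}(-1)^r\binom{\alpha}{r}g(t-rh)$. Let $\mathbf f:[0,\infty)\times\mathbb R^{p(m+1)}\to\mathbb R^p$ be any function that is constant with respect to its first argument. Then the autonomous system $$\bigl(D^{\alpha_1}x_1(t),\dots,D^{\alpha_p}x_p(t)\bigr)=\mathbf f\bigl(t,\mathbf x(t),\mathbf x'(t),\dots,\mathbf x^{(m)}(t)\bigr),\qquad t>0,$$ has no non-constant solution $\mathbf x=(x_1,\dots,x_p)$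 that is periodic on $(0,\infty)$, of any period $T>0$, and is of class $C^{\mathbf n}$, i.e. such that $x_i$ is $n_i$ times continuously differentiable on $(0,\infty)$ for every $i$. -/

import Mathlib

open Set Filter Topology

noncomputable section

/-- The three classical notions of fractional-order derivative. -/
inductive FracDerivKind where
  | riemannLiouville
  | caputo
  | grunwaldLetnikov

/-- The integer `[α] + 1`. -/
def fracOrder (α : ℝ) : ℕ := ⌊α⌋₊ + 1

/-- The Riemann-Liouville derivative of order `α` with base point `0`, at `t > 0`. -/
def riemannLiouvilleDeriv (α : ℝ) (g : ℝ → ℝ) (t : ℝ) : ℝ :=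
  1 / Real.Gamma (fracOrder α - α) *
    iteratedDeriv (fracOrder α)
      (fun u : ℝ => ∫ s in (0 : ℝ)..u, (u - s) ^ ((fracOrder α : ℝ) - α - 1) * g s) t

/-- The Caputo derivative of order `α` with base point `0`, at `t > 0`. -/
def caputoDeriv (α : ℝ) (g : ℝ → ℝ) (t : ℝ) : ℝ :=
  1 / Real.Gamma (fracOrder α - α) *
    ∫ s in (0 : ℝ)..t, (t - s) ^ ((fracOrder α : ℝ) - α - 1) * iteratedDeriv (fracOrder α) g s

/-- The Grunwald-Letnikov quotient with step `h > 0` and base point `0`, at `t > 0`. Only values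
of `g` on `[0, t]` occur; `Ring.choose α r` is `α (α - 1) ⋯ (α - r + 1) / r!`. -/
def grunwaldLetnikovQuotient (α : ℝ) (g : ℝ → ℝ) (t h : ℝ) : ℝ :=
  h ^ (-α) * ∑ r ∈ Finset.range (⌊t / h⌋₊ + 1), (-1 : ℝ) ^ r * Ring.choose α r * g (t - r * h)

/-- `HasFracDeriv K α g t y`: the fractional derivative of kind `K`, of order `α` and with base
point `0`, of the function `g` at the time `t > 0` is `y`. -/
def HasFracDeriv : FracDerivKind → ℝ → (ℝ → ℝ) → ℝ → ℝ → Prop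
  | .riemannLiouville, α, g, t, y => riemannLiouvilleDeriv α g t = y
  | .caputo, α, g, t, y => caputoDeriv α g t = y
  | .grunwaldLetnikov, α, g, t, y =>
      Tendsto (fun h : ℝ => grunwaldLetnikovQuotient α g t h) (𝓝[>] 0) (𝓝 y)

/-- The vector-valued function `x` is of class `C^𝐧` on `(0, ∞)`: its component `x i` has
`[α i] + 1` continuous derivatives there, as the fractional derivatives of order `α i` need. -/
def IsClassCn {p : ℕ} (α : Fin p → ℝ) (x : ℝ → Fin p → ℝ) : Prop :=
  ∀ i, ContDiffOn ℝ (fracOrder (α i) : ℕ) (fun s => x s i) (Ioi 0)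

/-- The jet `(x(t), x'(t), …, x⁽ᵐ⁾(t))`. -/
def jet {p : ℕ} (m : ℕ) (x : ℝ → Fin p → ℝ) (t : ℝ) : Fin (m + 1) → Fin p → ℝ :=
  fun k j => iteratedDeriv (k : ℕ) (fun s => x s j) t

/-- `x` solves `D^α x(t) = f(t, x(t), x'(t), …, x⁽ᵐ⁾(t))` at all times `t > 0`; the fractional
derivative of the component `i` is of kind `K i` and of order `α i`. -/
def IsSolution {p m : ℕ} (K : Fin p → FracDerivKind) (α : Fin p → ℝ)
    (f : ℝ → (Fin (m + 1) → Fin p → ℝ) → Fin p → ℝ) (x : ℝ → Fin p → ℝ) : Prop :=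
  ∀ t : ℝ, 0 < t → ∀ i, HasFracDeriv (K i) (α i) (fun s => x s i) t (f t (jet m x t) i)

/-- `x` is `T`-periodic on `(0, ∞)`. -/
def IsPeriodicOnPos {p : ℕ} (T : ℝ) (x : ℝ → Fin p → ℝ) : Prop :=
  ∀ t : ℝ, 0 < t → x (t + T) = x t

/-- `x` is constant on `(0, ∞)`. -/
def IsConstOnPos {p : ℕ} (x : ℝ → Fin p → ℝ) : Prop :=
  ∃ c : Fin p → ℝ, ∀ t : ℝ, 0 < t → x t = c

end

noncomputable section

/-- The contribution of one past period `[-T, 0]` to a convolution with the kernel `σ ↦ σ ^ a`. -/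
def memoryIntegral (G : ℝ → ℝ) (T a t : ℝ) : ℝ := ∫ s in (-T)..0, (t - s) ^ a * G s

theorem continuousOn_memory_kernel {G : ℝ → ℝ} (hG : Continuous G) {T t : ℝ} (a : ℝ)
    (hT : 0 < T) (ht : 0 < t) : ContinuousOn (fun s => (t - s) ^ a * G s) (uIcc (-T) 0) := by
  refine ContinuousOn.mul (ContinuousOn.rpow_const (by fun_prop) ?_) hG.continuousOn
  intro s hs
  rw [uIcc_of_le (by linarith)] at hs
  left
  have := hs.2
  linarith

theorem hasDerivAt_memoryIntegral {G : ℝ → ℝ} (hG : Continuous G) {T t : ℝ} (a : ℝ)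
    (hT : 0 < T) (ht : 0 < t) :
    HasDerivAt (memoryIntegral G T a) (a * memoryIntegral G T (a - 1) t) t := by
  have hcont : ContinuousOn (fun q : ℝ × ℝ => a * ((q.1 - q.2) ^ (a - 1) * G q.2))
      (Icc (t / 2) (2 * t) ×ˢ Icc (-T) 0) := by
    refine continuousOn_const.mul (ContinuousOn.mul (ContinuousOn.rpow_const (by fun_prop) ?_)
      (by fun_prop))
    rintro ⟨u, s⟩ ⟨hu, hs⟩
    left
    have h1 := hu.1
    have h2 := hs.2
    simp only at h1 h2 ⊢
    linarith
  obtain ⟨C, hC⟩ := (isCompact_Icc.prod isCompact_Icc).exists_bound_of_continuousOn hcont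
  have hnhds : Icc (t / 2) (2 * t) ∈ 𝓝 t := Icc_mem_nhds (by linarith) (by linarith)
  have key := intervalIntegral.hasDerivAt_integral_of_dominated_loc_of_deriv_le
    (μ := MeasureTheory.volume) (a := -T) (b := 0) (F := fun u s => (u - s) ^ a * G s)
    (F' := fun u s => a * ((u - s) ^ (a - 1) * G s)) (x₀ := t) (bound := fun _ => C) hnhds
    ?_ (continuousOn_memory_kernel hG a hT ht).intervalIntegrable ?_ ?_
    intervalIntegrable_const ?_
  · have := key.2
    rw [intervalIntegral.integral_const_mul] at this
    exact this
  · filter_upwards [hnhds] with u hu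
    exact ((continuousOn_memory_kernel hG a hT
      (by linarith [hu.1])).intervalIntegrable).aestronglyMeasurable_restrict_uIoc
  · exact (((continuousOn_memory_kernel hG (a - 1) hT ht).const_mul
      a).intervalIntegrable).aestronglyMeasurable_restrict_uIoc
  · refine Eventually.of_forall fun s hs u hu => hC (u, s) ⟨hu, ?_⟩
    rw [uIoc_of_le (by linarith)] at hs
    exact Ioc_subset_Icc_self hs
  · refine Eventually.of_forall fun s hs u hu => ?_
    rw [uIoc_of_le (by linarith)] at hs
    have hpos : u - s ≠ 0 := by linarith [hu.1, hs.2]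
    have := (((hasDerivAt_id u).sub_const s).rpow_const (p := a) (Or.inl hpos)).mul_const (G s)
    convert! this using 1
    simp only [id]
    ring

theorem iteratedDeriv_memoryIntegral {G : ℝ → ℝ} (hG : Continuous G) {T : ℝ} (a : ℝ)
    (hT : 0 < T) (n : ℕ) : ∀ t : ℝ, 0 < t → iteratedDeriv n (memoryIntegral G T a) t =
      (∏ j ∈ Finset.range n, (a - j)) * memoryIntegral G T (a - n) t := by
  induction n with
  | zero => simp
  | succ n ih =>
    intro t ht
    have hev : iteratedDeriv n (memoryIntegral G T a) =ᶠ[𝓝 t]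
        fun u => (∏ j ∈ Finset.range n, (a - j)) * memoryIntegral G T (a - n) u := by
      filter_upwards [Ioi_mem_nhds ht] with u hu using ih u hu
    rw [iteratedDeriv_succ, hev.deriv_eq,
      ((hasDerivAt_memoryIntegral hG (a - n) hT ht).const_mul _).deriv, Finset.prod_range_succ]
    push_cast
    rw [show a - n - 1 = a - (n + 1) by ring]
    ring

theorem memoryIntegral_sub_nat_eq_zero {G : ℝ → ℝ} (hG : Continuous G) {T a : ℝ} (hT : 0 < T)
    (ha : ∀ k : ℕ, a ≠ k) (h : ∀ t, 0 < t → memoryIntegral G T a t = 0) (k : ℕ) :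
    ∀ t, 0 < t → memoryIntegral G T (a - k) t = 0 := by
  intro t ht
  have h0 : iteratedDeriv k (memoryIntegral G T a) t = 0 := by
    have hev : memoryIntegral G T a =ᶠ[𝓝 t] fun _ => (0 : ℝ) := by
      filter_upwards [Ioi_mem_nhds ht] with u hu using h u hu
    rw [(hev.iteratedDeriv_eq k)]
    simp
  rw [iteratedDeriv_memoryIntegral hG a hT k t ht] at h0
  exact (mul_eq_zero.1 h0).resolve_left
    (Finset.prod_ne_zero_iff.2 fun j _ => sub_ne_zero.2 (ha j))

theorem integral_polynomial_inv_mul_eq_zero {G : ℝ → ℝ} (hG : Continuous G) {T a : ℝ}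
    (hT : 0 < T) (ha : ∀ k : ℕ, a ≠ k) (h : ∀ t, 0 < t → memoryIntegral G T a t = 0)
    (p : Polynomial ℝ) :
    ∫ s in (-T)..0, (1 - s) ^ a * G s * p.eval ((1 - s)⁻¹) = 0 := by
  have hpow : ∀ k : ℕ, ∀ s ∈ uIcc (-T) 0,
      (1 - s) ^ a * G s * ((1 - s)⁻¹) ^ k = (1 - s) ^ (a - k) * G s := by
    intro k s hs
    rw [uIcc_of_le (by linarith)] at hs
    rw [Real.rpow_sub_natCast (by linarith [hs.2] : (1 - s) ≠ 0)]
    rw [inv_pow]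
    ring
  have hterm : ∀ k : ℕ, ∫ s in (-T)..0, (1 - s) ^ a * G s * ((1 - s)⁻¹) ^ k = 0 := by
    intro k
    rw [intervalIntegral.integral_congr (hpow k)]
    exact memoryIntegral_sub_nat_eq_zero hG hT ha h k 1 one_pos
  have hint : ∀ k : ℕ, IntervalIntegrable
      (fun s => (1 - s) ^ a * G s * ((1 - s)⁻¹) ^ k) MeasureTheory.volume (-T) 0 := by
    intro k
    exact ((continuousOn_memory_kernel hG (a - k) hT one_pos).congr (hpow k)).intervalIntegrable
  simp_rw [Polynomial.eval_eq_sum_range, Finset.mul_sum]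
  rw [intervalIntegral.integral_finsetSum]
  · refine Finset.sum_eq_zero fun k _ => ?_
    simp_rw [mul_left_comm _ (p.coeff k)]
    rw [intervalIntegral.integral_const_mul, hterm, mul_zero]
  · intro k _
    simp_rw [mul_left_comm _ (p.coeff k)]
    exact (hint k).const_mul _

theorem eqOn_zero_of_memoryIntegral_eq_zero {G : ℝ → ℝ} (hG : Continuous G) {T a : ℝ}
    (hT : 0 < T) (ha : ∀ k : ℕ, a ≠ k) (h : ∀ t, 0 < t → memoryIntegral G T a t = 0) :
    ∀ s ∈ Icc (-T) 0, G s = 0 := by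
  have hle : -T ≤ 0 := by linarith
  have hK := continuousOn_memory_kernel hG a hT one_pos
  have hsq_cont : ContinuousOn (fun s => (1 - s) ^ a * G s * G s) (uIcc (-T) 0) :=
    hK.mul hG.continuousOn
  have hinv : ∀ s ∈ Icc (-T) 0, (1 - s)⁻¹ ∈ Icc ((1 + T)⁻¹) 1 := by
    intro s hs
    have h1 : 0 < 1 - s := by linarith [hs.2]
    exact ⟨inv_anti₀ h1 (by linarith [hs.1]), inv_le_one_of_one_le₀ (by linarith [hs.2])⟩
  have hinv_cont : ContinuousOn (fun s : ℝ => (1 - s)⁻¹) (uIcc (-T) 0) := by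
    refine ContinuousOn.inv₀ (by fun_prop) fun s hs => ?_
    rw [uIcc_of_le hle] at hs
    linarith [hs.2]
  have hsmall : ∀ ε, 0 < ε → ∫ s in (-T)..0, (1 - s) ^ a * G s * G s ≤
      ε * ∫ s in (-T)..0, |(1 - s) ^ a * G s| := by
    intro ε hε
    have hΦ : ContinuousOn (fun y : ℝ => G (1 - y⁻¹)) (Icc ((1 + T)⁻¹) 1) := by
      refine hG.comp_continuousOn (continuousOn_const.sub (ContinuousOn.inv₀ continuousOn_id ?_))
      intro y hy
      have : 0 < (1 + T)⁻¹ := by positivity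
      exact (this.trans_le hy.1).ne'
    obtain ⟨p, hp⟩ := exists_polynomial_near_of_continuousOn _ _ _ hΦ ε hε
    have hp_cont : ContinuousOn (fun s => (1 - s) ^ a * G s * p.eval ((1 - s)⁻¹))
        (uIcc (-T) 0) := hK.mul (p.continuous.comp_continuousOn hinv_cont)
    have hsub : ∫ s in (-T)..0, (1 - s) ^ a * G s * G s =
        ∫ s in (-T)..0, ((1 - s) ^ a * G s * G s -
          (1 - s) ^ a * G s * p.eval ((1 - s)⁻¹)) := by
      rw [intervalIntegral.integral_sub hsq_cont.intervalIntegrable hp_cont.intervalIntegrable,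
        integral_polynomial_inv_mul_eq_zero hG hT ha h p, sub_zero]
    rw [hsub, ← intervalIntegral.integral_const_mul]
    refine intervalIntegral.integral_mono_on hle (hsq_cont.sub hp_cont).intervalIntegrable
      (hK.abs.const_mul ε).intervalIntegrable fun s hs => ?_
    have h2 := hp _ (hinv s hs)
    simp only [inv_inv, sub_sub_cancel] at h2
    calc _ ≤ |(1 - s) ^ a * G s * G s - (1 - s) ^ a * G s * p.eval ((1 - s)⁻¹)| := le_abs_self _
      _ = |(1 - s) ^ a * G s| * |p.eval ((1 - s)⁻¹) - G s| := by
        rw [← mul_sub, abs_mul, abs_sub_comm]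
      _ ≤ |(1 - s) ^ a * G s| * ε := by gcongr
      _ = _ := mul_comm _ _
  have hnonpos : ∫ s in (-T)..0, (1 - s) ^ a * G s * G s ≤ 0 := by
    have hA : 0 ≤ ∫ s in (-T)..0, |(1 - s) ^ a * G s| :=
      intervalIntegral.integral_nonneg hle fun s _ => abs_nonneg _
    refine le_of_forall_pos_le_add fun ε hε => ?_
    refine (hsmall (ε / (1 + ∫ s in (-T)..0, |(1 - s) ^ a * G s|)) (by positivity)).trans ?_
    rw [zero_add, div_mul_eq_mul_div, div_le_iff₀ (by positivity)]
    nlinarith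
  intro s hs
  by_contra hne
  refine absurd hnonpos (not_le.2 (intervalIntegral.integral_pos (by linarith) ?_ ?_ ⟨s, hs, ?_⟩))
  · rwa [uIcc_of_le hle] at hsq_cont
  · intro u hu
    have : 0 < 1 - u := by linarith [hu.2]
    rw [mul_assoc]
    exact mul_nonneg (by positivity) (mul_self_nonneg _)
  · have : 0 < 1 - s := by linarith [hs.2]
    rw [mul_assoc]
    exact mul_pos (by positivity) (mul_self_pos.2 hne)

/-- The convolution integral over one period more differs by the memory of that period. -/
theorem integral_rpow_mul_add_period {G : ℝ → ℝ} (hG : Continuous G) {T a t : ℝ}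
    (hper : Function.Periodic G T) (ha : -1 < a) :
    ∫ s in (0 : ℝ)..(t + T), (t + T - s) ^ a * G s =
      memoryIntegral G T a t + ∫ s in (0 : ℝ)..t, (t - s) ^ a * G s := by
  have hint : ∀ b c : ℝ, IntervalIntegrable (fun s => (t - s) ^ a * G s)
      MeasureTheory.volume b c := by
    intro b c
    refine IntervalIntegrable.mul_continuousOn ?_ hG.continuousOn
    have := (intervalIntegral.intervalIntegrable_rpow' (a := t - b) (b := t - c) ha).comp_sub_left t
    simpa using this
  have hshift : ∫ s in (0 : ℝ)..(t + T), (t + T - s) ^ a * G s =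
      ∫ s in (-T)..t, (t - s) ^ a * G s := by
    have := intervalIntegral.integral_comp_add_right (a := -T) (b := t)
      (fun s => (t + T - s) ^ a * G s) T
    simp only [neg_add_cancel] at this
    rw [← this]
    refine intervalIntegral.integral_congr fun s _ => ?_
    simp only [hper s]
    congr 2
    ring
  rw [hshift, memoryIntegral, intervalIntegral.integral_add_adjacent_intervals (hint _ _)
    (hint _ _)]

theorem hasDerivAt_weighted_scaling_integral {w g : ℝ → ℝ} (hw : IntervalIntegrable w
    MeasureTheory.volume 0 1) (hg : ContDiff ℝ 1 g) (u : ℝ) :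
    HasDerivAt (fun v => ∫ τ in (0 : ℝ)..1, w τ * g (v * (1 - τ)))
      (∫ τ in (0 : ℝ)..1, w τ * (1 - τ) * deriv g (u * (1 - τ))) u := by
  have hg' : Continuous (deriv g) := hg.continuous_deriv le_rfl
  have hgc : Continuous g := hg.continuous
  obtain ⟨C, hC⟩ := (isCompact_Icc (a := -(|u| + 1)) (b := |u| + 1)).exists_bound_of_continuousOn
    hg'.continuousOn
  have hC0 : 0 ≤ C := (norm_nonneg _).trans (hC 0 ⟨by linarith [abs_nonneg u],
    by linarith [abs_nonneg u]⟩)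
  have hw1 : IntervalIntegrable (fun τ => w τ * (1 - τ)) MeasureTheory.volume 0 1 :=
    hw.mul_continuousOn (by fun_prop)
  refine (intervalIntegral.hasDerivAt_integral_of_dominated_loc_of_deriv_le
    (μ := MeasureTheory.volume) (a := 0) (b := 1) (F := fun v τ => w τ * g (v * (1 - τ)))
    (F' := fun v τ => w τ * (1 - τ) * deriv g (v * (1 - τ))) (x₀ := u)
    (bound := fun τ => ‖w τ * (1 - τ)‖ * C) (Metric.ball_mem_nhds u one_pos)
    ?_ ?_ ?_ ?_ ?_ ?_).2
  · exact Eventually.of_forall fun v =>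
      (hw.mul_continuousOn (g := fun τ => g (v * (1 - τ))) (by
        fun_prop)).aestronglyMeasurable_restrict_uIoc
  · exact hw.mul_continuousOn (g := fun τ => g (u * (1 - τ))) (by fun_prop)
  · exact (hw1.mul_continuousOn (g := fun τ => deriv g (u * (1 - τ)))
      (by fun_prop)).aestronglyMeasurable_restrict_uIoc
  · refine Eventually.of_forall fun τ hτ v hv => ?_
    rw [uIoc_of_le zero_le_one] at hτ
    rw [norm_mul]
    refine mul_le_mul_of_nonneg_left (hC _ (abs_le.1 ?_)) (norm_nonneg _)
    rw [abs_mul, abs_of_nonneg (by linarith [hτ.2] : 0 ≤ 1 - τ)]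
    rw [Metric.mem_ball, Real.dist_eq] at hv
    have h1 : |v| ≤ |u| + 1 := by
      have := abs_sub_abs_le_abs_sub v u
      linarith
    have := mul_le_mul h1 (by linarith [hτ.1] : 1 - τ ≤ 1) (by linarith [hτ.2])
      (by linarith [abs_nonneg u])
    linarith
  · exact hw1.norm.mul_const C
  · refine Eventually.of_forall fun τ _ v _ => ?_
    have h1 : HasDerivAt g (deriv g (v * (1 - τ))) (v * (1 - τ)) :=
      (hg.differentiable one_ne_zero _).hasDerivAt
    have h2 : HasDerivAt (fun v : ℝ => v * (1 - τ)) (1 - τ) v := by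
      simpa using (hasDerivAt_id v).mul_const (1 - τ)
    convert! (h1.comp v h2).const_mul (w τ) using 1
    ring

theorem contDiff_weighted_scaling_integral (n : ℕ) : ∀ {w g : ℝ → ℝ}, IntervalIntegrable w
    MeasureTheory.volume 0 1 → ContDiff ℝ n g →
    ContDiff ℝ n (fun v => ∫ τ in (0 : ℝ)..1, w τ * g (v * (1 - τ))) := by
  induction n with
  | zero =>
    intro w g hw hg
    have hgc : Continuous g := hg.continuous
    simp only [Nat.cast_zero, contDiff_zero]
    refine continuous_iff_continuousAt.2 fun u => ?_
    obtain ⟨C, hC⟩ := (isCompact_Icc (a := -(|u| + 1))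
      (b := |u| + 1)).exists_bound_of_continuousOn hgc.continuousOn
    refine intervalIntegral.continuousAt_of_dominated_interval (bound := fun τ => ‖w τ‖ * C)
      ?_ ?_ (hw.norm.mul_const C) ?_
    · exact Eventually.of_forall fun v =>
        (hw.mul_continuousOn (g := fun τ => g (v * (1 - τ))) (by
          fun_prop)).aestronglyMeasurable_restrict_uIoc
    · filter_upwards [Metric.ball_mem_nhds u one_pos] with v hv
      refine Eventually.of_forall fun τ hτ => ?_
      rw [uIoc_of_le zero_le_one] at hτ
      rw [norm_mul]
      refine mul_le_mul_of_nonneg_left (hC _ (abs_le.1 ?_)) (norm_nonneg _)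
      rw [abs_mul, abs_of_nonneg (by linarith [hτ.2] : 0 ≤ 1 - τ)]
      rw [Metric.mem_ball, Real.dist_eq] at hv
      have h1 : |v| ≤ |u| + 1 := by
        have := abs_sub_abs_le_abs_sub v u
        linarith
      have := mul_le_mul h1 (by linarith [hτ.1] : 1 - τ ≤ 1) (by linarith [hτ.2])
        (by linarith [abs_nonneg u])
      linarith
    · exact Eventually.of_forall fun τ _ => by fun_prop
  | succ n ih =>
    intro w g hw hg
    have hg1 : ContDiff ℝ 1 g := hg.of_le (by norm_cast; omega)
    have hd := hasDerivAt_weighted_scaling_integral hw hg1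
    push_cast
    rw [contDiff_succ_iff_deriv]
    refine ⟨fun u => (hd u).differentiableAt, by simp, ?_⟩
    rw [funext fun u => (hd u).deriv]
    push_cast at hg
    exact ih (hw.mul_continuousOn (by fun_prop)) (contDiff_succ_iff_deriv.1 hg).2.2

theorem integral_rpow_mul_eq_scaling {g : ℝ → ℝ} {a u : ℝ} (hu : 0 < u) :
    ∫ s in (0 : ℝ)..u, (u - s) ^ a * g s =
      u ^ (a + 1) * ∫ τ in (0 : ℝ)..1, τ ^ a * g (u * (1 - τ)) := by
  have h1 : ∫ s in (0 : ℝ)..u, (u - s) ^ a * g s = ∫ s in (0 : ℝ)..u, s ^ a * g (u - s) := by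
    have := intervalIntegral.integral_comp_sub_left (a := 0) (b := u)
      (fun s => s ^ a * g (u - s)) u
    simpa using this
  have h2 := intervalIntegral.mul_integral_comp_mul_left (a := 0) (b := 1)
    (f := fun s => s ^ a * g (u - s)) (c := u)
  simp only [mul_zero, mul_one] at h2
  rw [h1, ← h2, Real.rpow_add_one hu.ne', mul_comm (u ^ a), mul_assoc,
    ← intervalIntegral.integral_const_mul (u ^ a)]
  congr 1
  refine intervalIntegral.integral_congr fun τ hτ => ?_
  rw [uIcc_of_le zero_le_one] at hτ
  rw [Real.mul_rpow hu.le hτ.1, mul_one_sub]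
  ring

theorem contDiffAt_integral_rpow_mul {g : ℝ → ℝ} {n : ℕ} (hg : ContDiff ℝ n g) {a t : ℝ}
    (ha : -1 < a) (ht : 0 < t) :
    ContDiffAt ℝ n (fun u => ∫ s in (0 : ℝ)..u, (u - s) ^ a * g s) t := by
  have h := contDiff_weighted_scaling_integral n
    (intervalIntegral.intervalIntegrable_rpow' (a := 0) (b := 1) ha) hg
  refine ((Real.contDiffAt_rpow_const_of_ne (p := a + 1) ht.ne').mul
    h.contDiffAt).congr_of_eventuallyEq ?_
  filter_upwards [Ioi_mem_nhds ht] with u hu using integral_rpow_mul_eq_scaling hu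

/-- Equality of the Riemann-Liouville derivatives of a periodic function one period apart makes
the memory of that period vanish. -/
theorem memoryIntegral_eq_zero_of_riemannLiouville {g : ℝ → ℝ} {T α : ℝ}
    (hα : ∀ k : ℕ, α ≠ k) (hT : 0 < T) (hg : ContDiff ℝ (fracOrder α) g)
    (hper : Function.Periodic g T)
    (h : ∀ t, 0 < t → riemannLiouvilleDeriv α g (t + T) = riemannLiouvilleDeriv α g t) :
    ∀ t, 0 < t → memoryIntegral g T (-α - 1) t = 0 := by
  intro t ht
  have hn : α < fracOrder α := by
    rw [fracOrder]
    push_cast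
    exact Nat.lt_floor_add_one α
  set n := fracOrder α with hn_def
  set J : ℝ → ℝ := fun u => ∫ s in (0 : ℝ)..u, (u - s) ^ ((n : ℝ) - α - 1) * g s with hJ
  have ha : -1 < (n : ℝ) - α - 1 := by linarith
  have heq : iteratedDeriv n J (t + T) = iteratedDeriv n J t := by
    have := h t ht
    simp only [riemannLiouvilleDeriv] at this
    refine mul_left_cancel₀ (one_div_ne_zero (Real.Gamma_pos_of_pos ?_).ne') this
    linarith
  have hcd : ContDiffAt ℝ n J t := contDiffAt_integral_rpow_mul hg ha ht
  have hcdT : ContDiffAt ℝ n (fun u => J (u + T)) t := by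
    have : ContDiffAt ℝ n J (t + T) := contDiffAt_integral_rpow_mul hg ha (by linarith)
    exact ContDiffAt.comp (f := fun u : ℝ => u + T) t this (by fun_prop)
  have hmem : memoryIntegral g T ((n : ℝ) - α - 1) =ᶠ[𝓝 t] fun u => J (u + T) - J u := by
    refine Eventually.of_forall fun u => ?_
    simp only [hJ]
    rw [integral_rpow_mul_add_period hg.continuous hper ha]
    ring
  have hzero : iteratedDeriv n (memoryIntegral g T ((n : ℝ) - α - 1)) t = 0 := by
    rw [hmem.iteratedDeriv_eq n, iteratedDeriv_fun_sub hcdT hcd, iteratedDeriv_comp_add_const]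
    simp only [heq, sub_self]
  rw [iteratedDeriv_memoryIntegral hg.continuous _ hT n t ht] at hzero
  have hprod : (∏ j ∈ Finset.range n, ((n : ℝ) - α - 1 - j)) ≠ 0 := by
    refine Finset.prod_ne_zero_iff.2 fun j hj h0 => ?_
    have hj' : j + 1 ≤ n := Finset.mem_range.1 hj
    refine hα (n - (j + 1)) ?_
    push_cast [Nat.cast_sub hj']
    linarith
  have := (mul_eq_zero.1 hzero).resolve_left hprod
  rwa [show (n : ℝ) - α - 1 - n = -α - 1 by ring] at this

/-- The weights `(-1) ^ r * choose α r` of the Grünwald-Letnikov quotient. -/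
def grunwaldWeight (α : ℝ) (r : ℕ) : ℝ := (-1 : ℝ) ^ r * Ring.choose α r

theorem factorial_mul_grunwaldWeight (α : ℝ) (r : ℕ) :
    (r.factorial : ℝ) * grunwaldWeight α r = ∏ j ∈ Finset.range r, (-α + j) := by
  have h := Ring.descPochhammer_eq_factorial_smul_choose α r
  rw [nsmul_eq_mul] at h
  rw [grunwaldWeight, mul_left_comm, ← h, ← Polynomial.aeval_eq_smeval, Polynomial.aeval_def,
    Polynomial.eval₂_eq_eval_map, descPochhammer_map, descPochhammer_eval_eq_prod_range]
  have hsign : (-1 : ℝ) ^ r = ∏ _j ∈ Finset.range r, (-1 : ℝ) := by simp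
  rw [hsign, ← Finset.prod_mul_distrib]
  exact Finset.prod_congr rfl fun j _ => by ring

theorem rpow_mul_grunwaldWeight_succ {α : ℝ} {r : ℕ} (hr : 0 < r) :
    ((r : ℝ) + 1) * (r : ℝ) ^ α * grunwaldWeight α (r + 1) = (Real.GammaSeq (-α) r)⁻¹ := by
  have hf : (r.factorial : ℝ) ≠ 0 := by positivity
  have hr' : (0 : ℝ) < r := by exact_mod_cast hr
  rw [Real.GammaSeq, ← factorial_mul_grunwaldWeight, Nat.factorial_succ, Real.rpow_neg hr'.le]
  have := Real.rpow_pos_of_pos hr' α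
  push_cast
  field_simp

theorem tendsto_rpow_mul_grunwaldWeight {α : ℝ} (hα : ∀ k : ℕ, α ≠ k) :
    Tendsto (fun r : ℕ => (r : ℝ) ^ (1 + α) * grunwaldWeight α r) atTop
      (𝓝 (Real.Gamma (-α))⁻¹) := by
  have hΓ : Real.Gamma (-α) ≠ 0 :=
    Real.Gamma_ne_zero fun k => by simpa using hα k
  rw [← tendsto_add_atTop_iff_nat 1]
  have h1 := (Real.GammaSeq_tendsto_Gamma (-α)).inv₀ hΓ
  have h2 : Tendsto (fun r : ℕ => (((r : ℝ) + 1) / r) ^ α) atTop (𝓝 1) := by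
    have h3 : Tendsto (fun r : ℕ => ((r : ℝ) + 1) / r) atTop (𝓝 1) := by
      have := (tendsto_inv_atTop_nhds_zero_nat (𝕜 := ℝ)).const_add 1
      rw [add_zero] at this
      refine this.congr' ?_
      filter_upwards [eventually_gt_atTop 0] with r hr
      field_simp
    simpa using h3.rpow_const (p := α) (Or.inl one_ne_zero)
  have h4 := h2.mul h1
  rw [one_mul] at h4
  refine h4.congr' ?_
  filter_upwards [eventually_gt_atTop 0] with r hr
  have hr' : (0 : ℝ) < r := by exact_mod_cast hr
  rw [← rpow_mul_grunwaldWeight_succ hr, Real.div_rpow (by positivity) hr'.le]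
  push_cast
  rw [Real.rpow_add (by positivity), Real.rpow_one]
  have := Real.rpow_pos_of_pos hr' α
  field_simp

theorem rpow_mul_grunwaldWeight_eq {α h : ℝ} (hh : 0 < h) {r : ℕ} (hr : 0 < r) :
    h ^ (-α - 1) * grunwaldWeight α r =
      (r : ℝ) ^ (1 + α) * grunwaldWeight α r * (h * r) ^ (-α - 1) := by
  have hr' : (0 : ℝ) < r := by exact_mod_cast hr
  rw [Real.mul_rpow hh.le hr'.le, show (-α - 1) = -(1 + α) by ring, Real.rpow_neg hr'.le]
  have := Real.rpow_pos_of_pos hr' (1 + α)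
  field_simp

theorem tendsto_scaled_grunwaldWeight {α σ : ℝ} (hα : ∀ k : ℕ, α ≠ k) (hσ : 0 < σ)
    {h : ℕ → ℝ} {r : ℕ → ℕ} (hpos : ∀ N, 0 < h N) (hh : Tendsto h atTop (𝓝 0))
    (hr : Tendsto (fun N => h N * r N) atTop (𝓝 σ)) :
    Tendsto (fun N => h N ^ (-α - 1) * grunwaldWeight α (r N)) atTop
      (𝓝 ((Real.Gamma (-α))⁻¹ * σ ^ (-α - 1))) := by
  have hr_top : Tendsto r atTop atTop := by
    rw [← tendsto_natCast_atTop_iff (R := ℝ)]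
    have hinv : Tendsto (fun N => (h N)⁻¹) atTop atTop :=
      (tendsto_nhdsWithin_iff.2 ⟨hh, Eventually.of_forall hpos⟩).inv_tendsto_nhdsGT_zero
    refine (hr.pos_mul_atTop hσ hinv).congr fun N => ?_
    have := (hpos N).ne'
    field_simp
  have h1 := ((tendsto_rpow_mul_grunwaldWeight hα).comp hr_top).mul
    (hr.rpow_const (p := -α - 1) (Or.inl hσ.ne'))
  refine h1.congr' ?_
  filter_upwards [hr_top.eventually_gt_atTop 0] with N hN
  exact (rpow_mul_grunwaldWeight_eq (hpos N) hN).symm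

theorem integral_floor_div {h : ℝ} (hh : 0 < h) (Ψ : ℕ → ℝ) (N : ℕ) :
    IntervalIntegrable (fun σ => Ψ ⌊σ / h⌋₊) MeasureTheory.volume 0 (N * h) ∧
      ∫ σ in (0 : ℝ)..(N * h), Ψ ⌊σ / h⌋₊ = h * ∑ j ∈ Finset.range N, Ψ j := by
  induction N with
  | zero => simp
  | succ N ih =>
    have hlt : (N : ℝ) * h < ((N + 1 : ℕ) : ℝ) * h := by push_cast; nlinarith
    have hfl : ∀ σ ∈ Ioo ((N : ℝ) * h) (((N + 1 : ℕ) : ℝ) * h), Ψ N = Ψ ⌊σ / h⌋₊ := by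
      intro σ hσ
      congr 1
      symm
      rw [Nat.floor_eq_iff (div_nonneg ((by positivity : (0 : ℝ) ≤ N * h).trans hσ.1.le) hh.le),
        le_div_iff₀ hh, div_lt_iff₀ hh]
      refine ⟨hσ.1.le, ?_⟩
      have := hσ.2
      push_cast at this
      exact this
    have hii : IntervalIntegrable (fun σ => Ψ ⌊σ / h⌋₊) MeasureTheory.volume (N * h)
        ((N + 1 : ℕ) * h) := by
      refine (intervalIntegrable_const (c := Ψ N)).congr_uIoo ?_
      rw [uIoo_of_le hlt.le]
      exact hfl
    refine ⟨ih.1.trans hii, ?_⟩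
    rw [← intervalIntegral.integral_add_adjacent_intervals ih.1 hii, ih.2,
      Finset.sum_range_succ, mul_add]
    congr 1
    have : ∫ σ in ((N : ℝ) * h)..((N + 1 : ℕ) * h), Ψ ⌊σ / h⌋₊ =
        ∫ σ in ((N : ℝ) * h)..((N + 1 : ℕ) * h), Ψ N := by
      refine intervalIntegral.integral_congr_Ioo_of_le hlt.le fun σ hσ => (hfl σ hσ).symm
    rw [this, intervalIntegral.integral_const]
    push_cast
    simp only [smul_eq_mul]
    ring

theorem tendsto_mul_floor_div {h : ℕ → ℝ} (hpos : ∀ N, 0 < h N) (hh : Tendsto h atTop (𝓝 0))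
    {σ : ℝ} (hσ : 0 ≤ σ) : Tendsto (fun N => h N * ⌊σ / h N⌋₊) atTop (𝓝 σ) := by
  have hlow : Tendsto (fun N => σ - h N) atTop (𝓝 σ) := by simpa using hh.const_sub σ
  refine tendsto_of_tendsto_of_tendsto_of_le_of_le hlow tendsto_const_nhds (fun N => ?_)
    fun N => ?_
  · have := Nat.lt_floor_add_one (σ / h N)
    rw [div_lt_iff₀ (hpos N)] at this
    simp only
    linarith
  · have := Nat.floor_le (div_nonneg hσ (hpos N).le)
    rw [le_div_iff₀ (hpos N)] at this
    simp only
    linarith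

theorem tendsto_grunwaldLetnikovQuotient_sub {x g : ℝ → ℝ} (hxg : ∀ t, 0 < t → x t = g t)
    {α t : ℝ} (hα : ∀ k : ℕ, α ≠ k) (ht : 0 < t) {h : ℕ → ℝ} (hpos : ∀ N, 0 < h N)
    (hh : Tendsto h atTop (𝓝 0)) :
    Tendsto (fun N => grunwaldLetnikovQuotient α x t (h N) -
      grunwaldLetnikovQuotient α g t (h N)) atTop (𝓝 0) := by
  have hlim := ((tendsto_scaled_grunwaldWeight hα ht hpos hh
    (tendsto_mul_floor_div hpos hh ht.le)).abs.mul hh).mul_const |x 0 - g 0|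
  rw [mul_zero, zero_mul] at hlim
  refine squeeze_zero_norm (fun N => ?_) hlim
  have hN := hpos N
  set k := ⌊t / h N⌋₊
  have hk : (k : ℝ) * h N ≤ t := by
    rw [← le_div_iff₀ hN]
    exact Nat.floor_le (div_nonneg ht.le hN.le)
  have hsum : ∑ r ∈ Finset.range k, (-1 : ℝ) ^ r * Ring.choose α r * x (t - r * h N) =
      ∑ r ∈ Finset.range k, (-1 : ℝ) ^ r * Ring.choose α r * g (t - r * h N) := by
    refine Finset.sum_congr rfl fun r hr => ?_
    rw [hxg]
    have : ((r : ℝ) + 1) ≤ k := by exact_mod_cast Finset.mem_range.1 hr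
    nlinarith
  have hlast : |x (t - k * h N) - g (t - k * h N)| ≤ |x 0 - g 0| := by
    rcases (sub_nonneg.2 hk).eq_or_lt with h0 | h0
    · rw [← h0]
    · rw [hxg _ h0, sub_self, abs_zero]
      exact abs_nonneg _
  have hp : h N ^ (-α) = h N ^ (-α - 1) * h N := by
    rw [← Real.rpow_add_one hN.ne', sub_add_cancel]
  have heq : grunwaldLetnikovQuotient α x t (h N) - grunwaldLetnikovQuotient α g t (h N) =
      h N ^ (-α - 1) * grunwaldWeight α k * h N * (x (t - k * h N) - g (t - k * h N)) := by
    rw [grunwaldLetnikovQuotient, grunwaldLetnikovQuotient, Finset.sum_range_succ,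
      Finset.sum_range_succ, hsum, hp, grunwaldWeight]
    ring
  rw [heq, Real.norm_eq_abs, abs_mul, abs_mul, abs_of_pos hN]
  exact mul_le_mul_of_nonneg_left hlast (by positivity)

theorem grunwaldLetnikovQuotient_add_period_sub {g : ℝ → ℝ} {T t α h : ℝ} {N : ℕ}
    (hper : Function.Periodic g T) (ht : 0 < t) (hh : 0 < h) (hN : N * h = T) :
    grunwaldLetnikovQuotient α g (t + T) h - grunwaldLetnikovQuotient α g t h =
      ∫ σ in (0 : ℝ)..T, h ^ (-α - 1) * grunwaldWeight α (⌊t / h⌋₊ + 1 + ⌊σ / h⌋₊) *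
        g (t - (⌊t / h⌋₊ + 1 + ⌊σ / h⌋₊ : ℕ) * h) := by
  have hint := (integral_floor_div hh (fun j => h ^ (-α - 1) *
    grunwaldWeight α (⌊t / h⌋₊ + 1 + j) * g (t - (⌊t / h⌋₊ + 1 + j : ℕ) * h)) N).2
  rw [hN] at hint
  have hfl : ⌊(t + T) / h⌋₊ = ⌊t / h⌋₊ + N := by
    rw [← hN, add_div, mul_div_cancel_right₀ _ hh.ne',
      Nat.floor_add_natCast (div_nonneg ht.le hh.le)]
  have hp : h ^ (-α) = h ^ (-α - 1) * h := by
    rw [← Real.rpow_add_one hh.ne', sub_add_cancel]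
  have hterm : ∀ r : ℕ, g (t + T - r * h) = g (t - r * h) := fun r => by
    rw [← hper (t - r * h)]
    congr 1
    ring
  rw [hint, grunwaldLetnikovQuotient, grunwaldLetnikovQuotient, hfl]
  simp_rw [hterm]
  rw [add_right_comm, Finset.sum_range_add, hp, mul_add, add_sub_cancel_left, Finset.mul_sum,
    Finset.mul_sum]
  refine Finset.sum_congr rfl fun j _ => ?_
  rw [grunwaldWeight]
  ring

theorem exists_bound_rpow_mul_grunwaldWeight {α : ℝ} (hα : ∀ k : ℕ, α ≠ k) :
    ∃ C, ∀ r : ℕ, |(r : ℝ) ^ (1 + α) * grunwaldWeight α r| ≤ C := by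
  obtain ⟨C, hC⟩ := (tendsto_rpow_mul_grunwaldWeight hα).norm.bddAbove_range
  exact ⟨C, fun r => hC ⟨r, rfl⟩⟩

theorem tendsto_div_natCast_add_one (T : ℝ) :
    Tendsto (fun N : ℕ => T / ((N : ℝ) + 1)) atTop (𝓝 0) := by
  simpa [Function.comp_def] using (tendsto_const_div_atTop_nhds_zero_nat T).comp (tendsto_add_atTop_nat 1)

theorem tendsto_grunwaldLetnikovQuotient_add_period_sub {g : ℝ → ℝ} (hg : Continuous g)
    {T t α : ℝ} (hα0 : 0 < α) (hα : ∀ k : ℕ, α ≠ k) (hT : 0 < T) (ht : 0 < t)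
    (hper : Function.Periodic g T) :
    Tendsto (fun N : ℕ => grunwaldLetnikovQuotient α g (t + T) (T / (N + 1)) -
      grunwaldLetnikovQuotient α g t (T / (N + 1))) atTop
      (𝓝 ((Real.Gamma (-α))⁻¹ * memoryIntegral g T (-α - 1) t)) := by
  set h : ℕ → ℝ := fun N => T / (N + 1) with h_def
  have hpos : ∀ N, 0 < h N := fun N => by positivity
  have hh : Tendsto h atTop (𝓝 0) := tendsto_div_natCast_add_one T
  have hrw : ∀ N : ℕ, grunwaldLetnikovQuotient α g (t + T) (T / (N + 1)) -
      grunwaldLetnikovQuotient α g t (T / (N + 1)) = _ := fun N =>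
    grunwaldLetnikovQuotient_add_period_sub (α := α) (N := N + 1) hper ht (hpos N) (by
      push_cast
      field_simp)
  have hlimit : (Real.Gamma (-α))⁻¹ * memoryIntegral g T (-α - 1) t =
      ∫ σ in (0 : ℝ)..T, (Real.Gamma (-α))⁻¹ * (t + σ) ^ (-α - 1) * g (-σ) := by
    have := intervalIntegral.integral_comp_neg (a := 0) (b := T)
      (fun s => (Real.Gamma (-α))⁻¹ * ((t - s) ^ (-α - 1) * g s))
    simp only [neg_zero, sub_neg_eq_add] at this
    rw [memoryIntegral, ← intervalIntegral.integral_const_mul, ← this]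
    simp only [mul_assoc]
  have hr : ∀ σ, 0 ≤ σ → Tendsto (fun N => h N * (⌊t / h N⌋₊ + 1 + ⌊σ / h N⌋₊ : ℕ)) atTop
      (𝓝 (t + σ)) := by
    intro σ hσ
    have := ((tendsto_mul_floor_div hpos hh ht.le).add hh).add (tendsto_mul_floor_div hpos hh hσ)
    rw [add_zero] at this
    refine this.congr fun N => ?_
    push_cast
    ring
  obtain ⟨C, hC⟩ := exists_bound_rpow_mul_grunwaldWeight hα
  obtain ⟨M, hM⟩ := (hper.isBounded_of_continuous hT.ne' hg).exists_norm_le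
  rw [hlimit]
  simp_rw [hrw]
  refine intervalIntegral.tendsto_integral_filter_of_dominated_convergence
    (fun _ => C * t ^ (-α - 1) * M) ?_ ?_ intervalIntegrable_const ?_
  · refine Eventually.of_forall fun N => ?_
    have := (integral_floor_div (hpos N) (fun j => h N ^ (-α - 1) *
      grunwaldWeight α (⌊t / h N⌋₊ + 1 + j) * g (t - (⌊t / h N⌋₊ + 1 + j : ℕ) * h N)) (N + 1)).1
    rw [show ((N + 1 : ℕ) : ℝ) * h N = T by simp only [h_def]; push_cast; field_simp] at this
    exact this.aestronglyMeasurable_restrict_uIoc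
  · refine Eventually.of_forall fun N => Eventually.of_forall fun σ _ => ?_
    rw [rpow_mul_grunwaldWeight_eq (hpos N) (by omega), norm_mul, norm_mul]
    set r := ⌊t / h N⌋₊ + 1 + ⌊σ / h N⌋₊
    have hge : t ≤ h N * (r : ℕ) := by
      have h1 := (Nat.lt_floor_add_one (t / h N)).le
      rw [div_le_iff₀ (hpos N)] at h1
      have h2 : ((⌊t / h N⌋₊ : ℝ) + 1) ≤ (r : ℕ) := by
        exact_mod_cast Nat.le_add_right (⌊t / h N⌋₊ + 1) ⌊σ / h N⌋₊
      nlinarith [hpos N]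
    have h3 : ‖(h N * (r : ℕ)) ^ (-α - 1)‖ ≤ t ^ (-α - 1) := by
      rw [Real.norm_of_nonneg (Real.rpow_nonneg (ht.le.trans hge) _)]
      exact Real.rpow_le_rpow_of_nonpos ht hge (by linarith)
    have hC0 : 0 ≤ C := (abs_nonneg _).trans (hC 0)
    have := hC r
    rw [← Real.norm_eq_abs] at this
    gcongr
    exact hM _ (mem_range_self _)
  · refine Eventually.of_forall fun σ hσ => ?_
    rw [uIoc_of_le hT.le] at hσ
    have h1 := tendsto_scaled_grunwaldWeight hα (by linarith [hσ.1] : 0 < t + σ) hpos hh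
      (hr σ hσ.1.le)
    refine h1.mul ?_
    have h2 : Tendsto (fun N => t - (⌊t / h N⌋₊ + 1 + ⌊σ / h N⌋₊ : ℕ) * h N) atTop (𝓝 (-σ)) := by
      have := (hr σ hσ.1.le).const_sub t
      rw [sub_add_cancel_left] at this
      simpa only [mul_comm] using this
    exact (hg.tendsto _).comp h2

/-- Equality of the Grünwald-Letnikov derivatives of a periodic function one period apart makes
the memory of that period vanish. -/
theorem memoryIntegral_eq_zero_of_grunwaldLetnikov {x g : ℝ → ℝ}
    (hxg : ∀ t, 0 < t → x t = g t) (hg : Continuous g) {T t α y : ℝ} (hα0 : 0 < α)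
    (hα : ∀ k : ℕ, α ≠ k) (hT : 0 < T) (ht : 0 < t) (hper : Function.Periodic g T)
    (h1 : Tendsto (fun h => grunwaldLetnikovQuotient α x t h) (𝓝[>] 0) (𝓝 y))
    (h2 : Tendsto (fun h => grunwaldLetnikovQuotient α x (t + T) h) (𝓝[>] 0) (𝓝 y)) :
    memoryIntegral g T (-α - 1) t = 0 := by
  have hpos : ∀ N : ℕ, 0 < T / ((N : ℝ) + 1) := fun N => by positivity
  have hh : Tendsto (fun N : ℕ => T / ((N : ℝ) + 1)) atTop (𝓝 0) :=
    tendsto_div_natCast_add_one T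
  have hseq : Tendsto (fun N : ℕ => T / ((N : ℝ) + 1)) atTop (𝓝[>] 0) :=
    tendsto_nhdsWithin_iff.2 ⟨hh, Eventually.of_forall hpos⟩
  have hd1 := tendsto_grunwaldLetnikovQuotient_sub hxg hα ht hpos hh
  have hd2 := tendsto_grunwaldLetnikovQuotient_sub hxg hα (by linarith : 0 < t + T) hpos hh
  have hzero := ((h2.comp hseq).sub hd2).sub ((h1.comp hseq).sub hd1)
  simp only [sub_zero, sub_self] at hzero
  have huniq := tendsto_nhds_unique
    (tendsto_grunwaldLetnikovQuotient_add_period_sub hg hα0 hα hT ht hper)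
    (hzero.congr fun N => by simp only [Function.comp_apply]; ring)
  refine (mul_eq_zero.1 huniq).resolve_left (inv_ne_zero (Real.Gamma_ne_zero fun k => ?_))
  simpa using hα k

theorem apply_add_nat_mul_period {x : ℝ → ℝ} {T : ℝ} (hT : 0 < T)
    (hper : ∀ t, 0 < t → x (t + T) = x t) {s : ℝ} (hs : 0 < s) (k : ℕ) :
    x (s + k * T) = x s := by
  induction k with
  | zero => simp
  | succ k ih =>
    rw [← ih, ← hper (s + k * T) (by positivity)]
    congr 1
    push_cast
    ring

theorem apply_add_nat_mul_period_congr {x : ℝ → ℝ} {T : ℝ} (hT : 0 < T)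
    (hper : ∀ t, 0 < t → x (t + T) = x t) {s : ℝ} {j k : ℕ} (hj : 0 < s + j * T)
    (hk : 0 < s + k * T) : x (s + j * T) = x (s + k * T) := by
  wlog hjk : j ≤ k generalizing j k
  · exact (this hk hj (le_of_not_ge hjk)).symm
  obtain ⟨l, rfl⟩ := Nat.exists_eq_add_of_le hjk
  rw [← apply_add_nat_mul_period hT hper hj l]
  congr 1
  push_cast
  ring

/-- A periodic function of class `C^n` on `(0, ∞)` extends to one on `ℝ`. -/
theorem exists_periodic_contDiff_extension {x : ℝ → ℝ} {T : ℝ} (hT : 0 < T)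
    (hper : ∀ t, 0 < t → x (t + T) = x t) {n : ℕ} (hx : ContDiffOn ℝ n x (Ioi 0)) :
    ∃ g : ℝ → ℝ, Function.Periodic g T ∧ ContDiff ℝ n g ∧ ∀ t, 0 < t → x t = g t := by
  have hpos : ∀ s : ℝ, 0 < s + (⌊|s| / T⌋₊ + 1 : ℕ) * T := by
    intro s
    have h1 := Nat.lt_floor_add_one (|s| / T)
    rw [div_lt_iff₀ hT] at h1
    push_cast
    linarith [neg_abs_le s]
  have hg : ∀ (s : ℝ) (k : ℕ), 0 < s + k * T →
      x (s + (⌊|s| / T⌋₊ + 1 : ℕ) * T) = x (s + k * T) := fun s k hk =>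
    apply_add_nat_mul_period_congr hT hper (hpos s) hk
  refine ⟨fun s => x (s + (⌊|s| / T⌋₊ + 1 : ℕ) * T), fun s => ?_, ?_, fun t ht => ?_⟩
  · have h1 : s + T + (⌊|s + T| / T⌋₊ + 1 : ℕ) * T =
        s + ((⌊|s + T| / T⌋₊ + 1) + 1 : ℕ) * T := by
      push_cast
      ring
    have h2 := hpos (s + T)
    simp only
    rw [h1] at h2 ⊢
    exact (hg s _ h2).symm
  · refine contDiff_iff_contDiffAt.2 fun s => ?_
    set k := ⌊|s| / T⌋₊ + 1
    have h1 : ContDiffAt ℝ n x (s + (k : ℕ) * T) := hx.contDiffAt (Ioi_mem_nhds (hpos s))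
    have h2 : ContDiffAt ℝ n (fun u => x (u + (k : ℕ) * T)) s :=
      ContDiffAt.comp (f := fun u : ℝ => u + (k : ℕ) * T) s h1 (by fun_prop)
    refine h2.congr_of_eventuallyEq ?_
    have hev : ∀ᶠ u in 𝓝 s, 0 < u + (k : ℕ) * T :=
      (by fun_prop : Continuous fun u : ℝ => u + (k : ℕ) * T).continuousAt.eventually
        (Ioi_mem_nhds (hpos s))
    filter_upwards [hev] with u hu using hg u k hu
  · have := hg t 0 (by simpa using ht)
    simpa using this.symm

theorem periodic_iteratedDeriv {g : ℝ → ℝ} {T : ℝ} (hper : Function.Periodic g T) (n : ℕ) :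
    Function.Periodic (iteratedDeriv n g) T := by
  intro s
  have h := congrFun (iteratedDeriv_comp_add_const n g T) s
  rw [← h, funext hper]

theorem exists_const_of_iteratedDeriv_eq_zero (n : ℕ) : ∀ {g : ℝ → ℝ} {T : ℝ}, 0 < T →
    Function.Periodic g T → ContDiff ℝ n g → (∀ s, iteratedDeriv n g s = 0) →
    ∃ c, ∀ s, g s = c := by
  induction n with
  | zero =>
    intro g T _ _ _ h
    exact ⟨0, by simpa using h⟩
  | succ n ih =>
    intro g T hT hper hg h
    push_cast at hg
    obtain ⟨hdiff, -, hg'⟩ := contDiff_succ_iff_deriv.1 hg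
    have hper' : Function.Periodic (deriv g) T := by
      simpa [iteratedDeriv_one] using periodic_iteratedDeriv hper 1
    obtain ⟨c, hc⟩ := ih hT hper' hg' (by simpa [iteratedDeriv_succ'] using h)
    have hconst : ∀ a b, g a - c * a = g b - c * b := by
      refine is_const_of_deriv_eq_zero (f := fun s => g s - c * s) (by fun_prop) fun s => ?_
      have h1 := (hdiff s).hasDerivAt.sub ((hasDerivAt_id s).const_mul c)
      rw [hc] at h1
      simpa [Pi.sub_def] using h1.deriv
    have hcT : c * T = 0 := by
      have h1 := hconst T 0
      have h2 := hper 0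
      rw [zero_add] at h2
      rw [h2] at h1
      linarith
    have hc0 : c = 0 := (mul_eq_zero.1 hcT).resolve_right hT.ne'
    refine ⟨g 0, fun s => ?_⟩
    have := hconst s 0
    rw [hc0] at this
    linarith

theorem periodic_eq_zero_of_eqOn {G : ℝ → ℝ} {T : ℝ} (hT : 0 < T) (hper : Function.Periodic G T)
    (h : ∀ s ∈ Icc (-T) 0, G s = 0) (s : ℝ) : G s = 0 := by
  obtain ⟨u, hu, hus⟩ := hper.exists_mem_Ico hT s (-T)
  rw [hus]
  exact h u ⟨hu.1, by linarith [hu.2]⟩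

/-- Equality of the Caputo derivatives of a periodic function one period apart makes the memory
of that period vanish. -/
theorem memoryIntegral_eq_zero_of_caputo {g : ℝ → ℝ} {T α : ℝ}
    (hg : ContDiff ℝ (fracOrder α) g) (hper : Function.Periodic g T) {t : ℝ}
    (h : caputoDeriv α g (t + T) = caputoDeriv α g t) :
    memoryIntegral (iteratedDeriv (fracOrder α) g) T (fracOrder α - α - 1) t = 0 := by
  have hn : α < fracOrder α := by
    rw [fracOrder]
    push_cast
    exact Nat.lt_floor_add_one α
  have h' := mul_left_cancel₀ (one_div_ne_zero (Real.Gamma_pos_of_pos (by linarith)).ne') h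
  rw [integral_rpow_mul_add_period (hg.continuous_iteratedDeriv _ le_rfl)
    (periodic_iteratedDeriv hper _) (by linarith)] at h'
  linarith

theorem riemannLiouvilleDeriv_congr {x g : ℝ → ℝ} (hxg : ∀ t, 0 < t → x t = g t) (α : ℝ) {t : ℝ}
    (ht : 0 < t) : riemannLiouvilleDeriv α x t = riemannLiouvilleDeriv α g t := by
  rw [riemannLiouvilleDeriv, riemannLiouvilleDeriv]
  congr 1
  refine EventuallyEq.iteratedDeriv_eq _ ?_
  filter_upwards [Ioi_mem_nhds ht] with u hu
  refine intervalIntegral.integral_congr_Ioo_of_le (le_of_lt hu) fun s hs => ?_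
  simp only [hxg s hs.1]

theorem caputoDeriv_congr {x g : ℝ → ℝ} (hxg : ∀ t, 0 < t → x t = g t) (α : ℝ) {t : ℝ}
    (ht : 0 < t) : caputoDeriv α x t = caputoDeriv α g t := by
  rw [caputoDeriv, caputoDeriv]
  congr 1
  refine intervalIntegral.integral_congr_Ioo_of_le ht.le fun s hs => ?_
  have hev : x =ᶠ[𝓝 s] g := by
    filter_upwards [Ioi_mem_nhds hs.1] with u hu using hxg u hu
  simp only [hev.iteratedDeriv_eq]

/-- A periodic function whose fractional derivative is periodic is constant. -/
theorem exists_const_of_hasFracDeriv_periodic {K : FracDerivKind} {α T : ℝ} (hα0 : 0 < α)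
    (hα : ∀ k : ℕ, α ≠ k) (hT : 0 < T) {x y : ℝ → ℝ} (hx : ContDiffOn ℝ (fracOrder α) x (Ioi 0))
    (hper : ∀ t, 0 < t → x (t + T) = x t) (hy : ∀ t, 0 < t → y (t + T) = y t)
    (h : ∀ t, 0 < t → HasFracDeriv K α x t (y t)) : ∃ c, ∀ t, 0 < t → x t = c := by
  obtain ⟨g, hgper, hg, hxg⟩ := exists_periodic_contDiff_extension hT hper hx
  have hshift : ∀ t, 0 < t → HasFracDeriv K α x (t + T) (y t) := fun t ht => by
    rw [← hy t ht]
    exact h _ (by linarith)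
  suffices ∃ c, ∀ s, g s = c by
    obtain ⟨c, hc⟩ := this
    exact ⟨c, fun t ht => (hxg t ht).trans (hc t)⟩
  have hzero : (∀ t, 0 < t → memoryIntegral g T (-α - 1) t = 0) → ∃ c, ∀ s, g s = c := fun h0 =>
    ⟨0, periodic_eq_zero_of_eqOn hT hgper (eqOn_zero_of_memoryIntegral_eq_zero hg.continuous hT
      (fun k hk => by linarith [(Nat.cast_nonneg k : (0 : ℝ) ≤ k)]) h0)⟩
  cases K with
  | riemannLiouville =>
    refine hzero (memoryIntegral_eq_zero_of_riemannLiouville hα hT hg hgper fun t ht => ?_)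
    rw [← riemannLiouvilleDeriv_congr hxg α ht,
      ← riemannLiouvilleDeriv_congr hxg α (by linarith : 0 < t + T)]
    exact (hshift t ht).trans (h t ht).symm
  | caputo =>
    refine exists_const_of_iteratedDeriv_eq_zero (fracOrder α) hT hgper hg
      (periodic_eq_zero_of_eqOn hT (periodic_iteratedDeriv hgper _)
        (eqOn_zero_of_memoryIntegral_eq_zero (hg.continuous_iteratedDeriv _ le_rfl) hT
          (a := fracOrder α - α - 1) (fun k hk => ?_) fun t ht =>
          memoryIntegral_eq_zero_of_caputo hg hgper ?_))
    · have hfl := Nat.floor_le hα0.le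
      have hk0 : (0 : ℝ) ≤ k := Nat.cast_nonneg k
      rw [fracOrder] at hk
      push_cast at hk
      exact hα ⌊α⌋₊ (by linarith)
    · rw [← caputoDeriv_congr hxg α ht, ← caputoDeriv_congr hxg α (by linarith : 0 < t + T)]
      exact (hshift t ht).trans (h t ht).symm
  | grunwaldLetnikov =>
    exact hzero fun t ht => memoryIntegral_eq_zero_of_grunwaldLetnikov hxg hg.continuous hα0 hα hT
      ht hgper (h t ht) (hshift t ht)

theorem jet_add_period {p : ℕ} (m : ℕ) {x : ℝ → Fin p → ℝ} {T : ℝ} (hper : IsPeriodicOnPos T x)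
    {t : ℝ} (ht : 0 < t) : jet m x (t + T) = jet m x t := by
  funext k j
  have hev : (fun s => x (s + T) j) =ᶠ[𝓝 t] fun s => x s j := by
    filter_upwards [Ioi_mem_nhds ht] with s hs using congrFun (hper s hs) j
  have h := congrFun (iteratedDeriv_comp_add_const (k : ℕ) (fun s => x s j) T) t
  rw [jet, jet, ← h, hev.iteratedDeriv_eq]

end

theorem corollary3 (p m : ℕ) (K : Fin p → FracDerivKind) (α : Fin p → ℝ)
    (hα_pos : ∀ i, 0 < α i) (hα_nonint : ∀ i, ∀ k : ℕ, α i ≠ (k : ℝ))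
    (f : ℝ → (Fin (m + 1) → Fin p → ℝ) → Fin p → ℝ)
    (hf : ∀ s t : ℝ, 0 ≤ s → 0 ≤ t → ∀ v, f s v = f t v) :
    ¬ ∃ x : ℝ → Fin p → ℝ,
      IsClassCn α x ∧ IsSolution K α f x ∧
        (∃ T : ℝ, 0 < T ∧ IsPeriodicOnPos T x) ∧ ¬ IsConstOnPos x := by
  rintro ⟨x, hx, hsol, ⟨T, hT, hper⟩, hconst⟩
  have hcomp : ∀ i, ∃ c, ∀ t, 0 < t → x t i = c := fun i =>
    exists_const_of_hasFracDeriv_periodic (hα_pos i) (hα_nonint i) hT (hx i)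
      (fun t ht => congrFun (hper t ht) i) (y := fun t => f t (jet m x t) i)
      (fun t ht => by
        rw [jet_add_period m hper ht, hf (t + T) t (by linarith) ht.le])
      fun t ht => hsol t ht i
  choose c hc using hcomp
  exact hconst ⟨c, fun t ht => funext fun i => hc i t ht⟩
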